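/- Let $G$ be a connected simple graph of order $n$ whose adjacency matrix has spectrum $\{[\lambda]^1,[\mu]^{n-k-t-1},[0]^t,[-\mu]^k\}$ (exponents are multiplicities), where $t,k\ge 1$, $t+k\le n-2$ and $\lambda>\mu>0$ are real. Then $G$ is integral, i.e. all eigenvalues of $G$ are integers. If moreover $G$ is regular, then exactly one of the following holds: (a) $\mu$ is an even integer and $G$ is isomorphic to the complement of $Q_3\circledast J_{\mu/2}$; or (b) $\lambda$ is the only simple eigenvalue of $G$ (the only eigenvalue of multiplicity one). Here $Q_3$ is the graph of the three-dimensional cube and, for a graph $H$ with $N$ vertices and adjacency matrix $A$ and an integer $m\ge 1$, $H\circledast J_m$ is the graph with adjacency matrix $(A+I_N)\otimes J_m-I_{Nm}$, where $J_m$ is the $m\times m$ all-ones matrix. -/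

import Mathlib

/-- The spectrum of a finite graph: the multiset of the eigenvalues of its adjacency matrix
(roots of the characteristic polynomial, with multiplicity).  The matrix is real symmetric, so
this has as many elements as the graph has vertices, and algebraic and geometric multiplicities
agree. -/
noncomputable def graphSpectrum {V : Type*} [Fintype V] [DecidableEq V] (G : SimpleGraph V)
    [DecidableRel G.Adj] : Multiset ℝ :=
  (G.adjMatrix ℝ).charpoly.roots

/-- A graph is integral when all of its eigenvalues are integers. -/
def IsIntegralGraph {V : Type*} [Fintype V] [DecidableEq V] (G : SimpleGraph V)
    [DecidableRel G.Adj] : Prop :=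
  ∀ x ∈ graphSpectrum G, ∃ z : ℤ, x = (z : ℝ)

/-- A real number is a simple eigenvalue of a graph when it is an eigenvalue of multiplicity
one. -/
def IsSimpleEigenvalue {V : Type*} [Fintype V] [DecidableEq V] (G : SimpleGraph V)
    [DecidableRel G.Adj] (x : ℝ) : Prop :=
  (graphSpectrum G).count x = 1

/-- The three-dimensional cube graph: vertices are the 0-1 vectors of length three, adjacent
when they differ in exactly one coordinate. -/
def cubeGraph : SimpleGraph (Fin 3 → Bool) where
  Adj x y := hammingDist x y = 1
  symm := ⟨fun x y h => by rw [hammingDist_comm]; exact h⟩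
  loopless := ⟨fun x h => by simp at h⟩

/-- The graph `G ⊛ J_m`: every vertex of `G` is replaced by a clique on `m` vertices, and two
vertices in different cliques are adjacent when the original vertices are.  Its adjacency matrix
is `(A + I) ⊗ J_m - I`, see `adjMatrix_circledastJ`. -/
def circledastJ {V : Type*} (G : SimpleGraph V) (m : ℕ) : SimpleGraph (V × Fin m) where
  Adj p q := p ≠ q ∧ (p.1 = q.1 ∨ G.Adj p.1 q.1)
  symm := ⟨fun _ _ h => ⟨h.1.symm, h.2.imp Eq.symm SimpleGraph.Adj.symm⟩⟩
  loopless := ⟨fun _ h => h.1 rfl⟩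

open scoped Kronecker in
theorem adjMatrix_circledastJ {V : Type*} [DecidableEq V] (G : SimpleGraph V)
    [DecidableRel G.Adj] (m : ℕ) [DecidableRel (circledastJ G m).Adj] :
    (circledastJ G m).adjMatrix ℝ =
      (G.adjMatrix ℝ + 1) ⊗ₖ (Matrix.of fun _ _ : Fin m => (1 : ℝ)) - 1 := by
  have hadj : ∀ p q, (circledastJ G m).Adj p q ↔ p ≠ q ∧ (p.1 = q.1 ∨ G.Adj p.1 q.1) :=
    fun _ _ => Iff.rfl
  ext ⟨u, i⟩ ⟨v, j⟩
  by_cases huv : u = v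
  · subst huv
    by_cases hij : i = j <;> simp [SimpleGraph.adjMatrix_apply, hadj, hij]
  · simp [SimpleGraph.adjMatrix_apply, hadj, huv]

/-! ### Orthonormal eigensystems and traces of powers. -/

section Spectral

open Matrix Finset

variable {V : Type*} [Fintype V] [DecidableEq V]

/-! Write `a` for the multiplicity of `μ`. Trace zero gives `λ = cμ` with `c = k - a` an integer,
and `c ≥ 2` since `λ > μ`. The second and third power sums are integers of the form `μ²·r` and
`μ³·s` with `r`, `s` nonzero integers, so `μ` is rational; being an algebraic integer, it is an
integer.

Let `G` be regular. Then `λ` is the degree, and counting closed walks of length 2 gives `nc = μ(c² +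
a + k)`. Since `k = a + c ≥ 3`, another simple eigenvalue `θ` can only be `0` or `μ`. A quadratic in
`A` killing the two remaining eigenvalues is a combination of `J` and the projection onto the
`θ`-eigenvector; its constant diagonal makes that vector a `±1`-vector `s`
(`exists_sign_eigenvector`), so codegrees depend only on adjacency and signs.

If `θ = 0`, integrality of codegrees contradicts the walk count (`not_sign_kernel`). If `θ = μ`,
nonadjacent vertices of equal sign are twins, which forces `c = 2`, `n = 4μ` and the blown-up
structure (`exists_iso_compl_circledastJ_cubeGraph`). Conversely, that structure has `n = 4μ`, which
forces `a = 1`, so the two alternatives exclude each other. -/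

theorem Matrix.IsHermitian.exists_eigensystem {A : Matrix V V ℝ} (hA : A.IsHermitian) :
    ∃ (ev : V → ℝ) (w : V → V → ℝ), A.charpoly.roots = univ.val.map ev ∧
      (∀ i j, ∑ x, w i x * w j x = if i = j then 1 else 0) ∧
      (∀ x y, ∑ j, w j x * w j y = if x = y then 1 else 0) ∧
      ∀ j, A *ᵥ w j = ev j • w j := by
  have hw : ∀ i j, ∑ x, hA.eigenvectorBasis i x * hA.eigenvectorBasis j x =
      if i = j then 1 else 0 := by
    intro i j
    have h := orthonormal_iff_ite.mp hA.eigenvectorBasis.orthonormal i j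
    rw [← h, PiLp.inner_apply]
    exact sum_congr rfl fun x _ => by simp [mul_comm]
  refine ⟨hA.eigenvalues, fun j x => hA.eigenvectorBasis j x, ?_, hw, ?_, ?_⟩
  · simpa using hA.roots_charpoly_eq_eigenvalues
  · let W : Matrix V V ℝ := Matrix.of fun j x => hA.eigenvectorBasis j x
    have h1 : W * Wᵀ = 1 := by
      ext i j
      simp only [Matrix.mul_apply, Matrix.transpose_apply, Matrix.one_apply]
      exact hw i j
    have h2 : Wᵀ * W = 1 := mul_eq_one_comm.mp h1
    intro x y
    have := congrFun (congrFun h2 x) y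
    simpa [Matrix.mul_apply, Matrix.one_apply, W] using this
  · exact hA.mulVec_eigenvectorBasis

theorem Matrix.pow_apply_eq_sum_eigensystem {A : Matrix V V ℝ} {ev : V → ℝ} {w : V → V → ℝ}
    (hcol : ∀ x y, ∑ j, w j x * w j y = if x = y then 1 else 0)
    (hA : ∀ j, A *ᵥ w j = ev j • w j) (p : ℕ) (x y : V) :
    (A ^ p) x y = ∑ j, ev j ^ p * (w j x * w j y) := by
  induction p generalizing x y with
  | zero => simp [hcol, Matrix.one_apply]
  | succ p ih =>
    rw [pow_succ', Matrix.mul_apply]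
    simp_rw [ih, mul_sum]
    rw [sum_comm]
    refine sum_congr rfl fun j _ => ?_
    have h := congrFun (hA j) x
    simp only [mulVec, dotProduct, Pi.smul_apply, smul_eq_mul] at h
    rw [show ev j ^ (p + 1) * (w j x * w j y) = ev j ^ p * (ev j * w j x) * w j y by ring, ← h,
      mul_sum, sum_mul]
    exact sum_congr rfl fun z _ => by ring

theorem Matrix.IsHermitian.trace_pow_eq_sum_roots {A : Matrix V V ℝ} (hA : A.IsHermitian)
    (p : ℕ) : (A ^ p).trace = (A.charpoly.roots.map (· ^ p)).sum := by
  obtain ⟨ev, w, hroots, hrow, hcol, hev⟩ := hA.exists_eigensystem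
  rw [hroots, Matrix.trace]
  simp only [Matrix.diag_apply, Matrix.pow_apply_eq_sum_eigensystem hcol hev]
  rw [sum_comm]
  simp only [← mul_sum, hrow, if_true, mul_one, Multiset.map_map]
  rfl

end Spectral

/-! ### Integrality of eigenvalues, and simple eigenvalues of regular graphs. -/

section Graph

open Matrix Finset

variable {V : Type*} [Fintype V] {G : SimpleGraph V} [DecidableRel G.Adj]

/-- The all-ones vector is an eigenvector for `d`, and `A` is symmetric, so eigenvectors for other
eigenvalues are orthogonal to it. -/
theorem SimpleGraph.IsRegularOfDegree.mul_sum_eigenvector_eq_zero {d : ℕ}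
    (hd : G.IsRegularOfDegree d) {ev : V → ℝ} {w : V → V → ℝ}
    (hev : ∀ j, G.adjMatrix ℝ *ᵥ w j = ev j • w j) (j : V) :
    (d - ev j) * ∑ x, w j x = 0 := by
  have hone : G.adjMatrix ℝ *ᵥ (fun _ => (1 : ℝ)) = fun _ => (d : ℝ) := by
    ext x
    have := SimpleGraph.adjMatrix_mulVec_const_apply_of_regular (α := ℝ) (a := 1) hd (v := x)
    simpa [Function.const_def] using this
  have h1 : (fun _ => (1 : ℝ)) ⬝ᵥ (G.adjMatrix ℝ *ᵥ w j) =
      (G.adjMatrix ℝ *ᵥ (fun _ => (1 : ℝ))) ⬝ᵥ w j := by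
    rw [Matrix.dotProduct_mulVec, ← Matrix.mulVec_transpose, SimpleGraph.transpose_adjMatrix]
  rw [hev, hone] at h1
  simp only [dotProduct, Pi.smul_apply, smul_eq_mul, one_mul, ← mul_sum] at h1
  rw [sub_mul, h1, sub_self]

variable [DecidableEq V]

theorem adjMatrix_sq_apply (x y : V) :
    (G.adjMatrix ℝ ^ 2) x y = ((univ.filter fun z => G.Adj x z ∧ G.Adj y z).card : ℝ) := by
  rw [sq, Matrix.mul_apply]
  simp only [SimpleGraph.adjMatrix_apply, mul_ite, mul_one, mul_zero, ← ite_and,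
    G.adj_comm _ y]
  rw [sum_boole]
  simp only [and_comm]

theorem isIntegral_of_mem_graphSpectrum {x : ℝ} (hx : x ∈ graphSpectrum G) : IsIntegral ℤ x := by
  have hmap : (G.adjMatrix ℤ).map (algebraMap ℤ ℝ) = G.adjMatrix ℝ := by
    ext i j
    simp [SimpleGraph.adjMatrix_apply]
  refine ⟨(G.adjMatrix ℤ).charpoly, Matrix.charpoly_monic _, ?_⟩
  have h := (Polynomial.mem_roots'.mp hx).2
  rw [← hmap] at h
  change Polynomial.IsRoot ((RingHom.mapMatrix (algebraMap ℤ ℝ) (G.adjMatrix ℤ)).charpoly) x at h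
  rw [RingHom.mapMatrix_apply, Matrix.charpoly_map] at h
  rwa [Polynomial.IsRoot, Polynomial.eval_map] at h

theorem exists_int_sum_graphSpectrum_pow (p : ℕ) :
    ∃ z : ℤ, ((graphSpectrum G).map (· ^ p)).sum = z := by
  have hA : (G.adjMatrix ℝ).IsHermitian := SimpleGraph.isHermitian_adjMatrix ..
  refine ⟨(G.adjMatrix ℤ ^ p).trace, ?_⟩
  rw [graphSpectrum, ← hA.trace_pow_eq_sum_roots]
  have hmap : G.adjMatrix ℝ = RingHom.mapMatrix (Int.castRingHom ℝ) (G.adjMatrix ℤ) := by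
    ext i j
    simp [SimpleGraph.adjMatrix_apply]
  rw [hmap, ← map_pow]
  simp [Matrix.trace]

theorem exists_int_of_mem_graphSpectrum_of_rat {q : ℚ} (hq : (q : ℝ) ∈ graphSpectrum G) :
    ∃ z : ℤ, (q : ℝ) = z := by
  have h1 : IsIntegral ℤ (algebraMap ℚ ℝ q) := isIntegral_of_mem_graphSpectrum hq
  have h2 : IsIntegral ℤ q :=
    (isIntegral_algebraMap_iff (algebraMap ℚ ℝ).injective).mp h1
  obtain ⟨z, hz⟩ := IsIntegrallyClosed.isIntegral_iff.mp h2
  exact ⟨z, by rw [← hz]; simp⟩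

theorem eigenvalue_le_degree {d : ℕ} (hd : G.IsRegularOfDegree d) {x : ℝ}
    {v : V → ℝ} (hv : v ≠ 0) (hx : G.adjMatrix ℝ *ᵥ v = x • v) : x ≤ d := by
  have hev : Module.End.HasEigenvalue (Matrix.toLin' (G.adjMatrix ℝ)) x :=
    Module.End.hasEigenvalue_of_hasEigenvector
      ⟨Module.End.mem_eigenspace_iff.mpr (by simpa using hx), hv⟩
  obtain ⟨i, hi⟩ := eigenvalue_mem_ball hev
  rw [Metric.mem_closedBall, Real.dist_eq] at hi
  have h0 : G.adjMatrix ℝ i i = 0 := by simp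
  rw [h0, sub_zero] at hi
  refine (le_abs_self x).trans (hi.trans ?_)
  refine (sum_le_sum_of_subset_of_nonneg (erase_subset _ _)
    fun _ _ _ => norm_nonneg _).trans_eq ?_
  rw [← hd i, ← G.card_neighborFinset_eq_degree i]
  simp [SimpleGraph.adjMatrix_apply, apply_ite, sum_boole, SimpleGraph.neighborFinset_eq_filter]

/-- Gershgorin bounds every eigenvalue by `d`. If all were smaller than `d`, the all-ones vector
would be orthogonal to a whole eigenbasis. -/
theorem eq_degree_of_isGreatest_graphSpectrum [Nonempty V] {d : ℕ} (hd : G.IsRegularOfDegree d)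
    {lam : ℝ} (hlam : lam ∈ graphSpectrum G) (hmax : ∀ x ∈ graphSpectrum G, x ≤ lam) :
    lam = d := by
  have hA : (G.adjMatrix ℝ).IsHermitian := SimpleGraph.isHermitian_adjMatrix ..
  obtain ⟨ev, w, hroots, hrow, hcol, hev⟩ := hA.exists_eigensystem
  change graphSpectrum G = _ at hroots
  have hmem : ∀ j, ev j ∈ graphSpectrum G := fun j => by
    rw [hroots]; exact Multiset.mem_map_of_mem _ (mem_univ j)
  have hcoef := hd.mul_sum_eigenvector_eq_zero hev
  refine le_antisymm ?_ ?_
  · rw [hroots, Multiset.mem_map] at hlam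
    obtain ⟨i, -, hi⟩ := hlam
    refine eigenvalue_le_degree hd (v := w i) ?_ (by rw [hev, hi])
    intro h0
    have := hrow i i
    simp [h0] at this
  · by_contra hlt
    have hw : ∀ j, ∑ x, w j x = 0 := fun j =>
      (mul_eq_zero.mp (hcoef j)).resolve_left fun h0 =>
        hlt ((sub_eq_zero.mp h0).trans_le (hmax _ (hmem j)))
    have h1 : ∑ j, (∑ x, w j x) * w j (Classical.arbitrary V) = 1 := by
      simp_rw [sum_mul]
      rw [sum_comm]
      simp [hcol]
    simp [hw] at h1

/-- If the degree is a simple eigenvalue of a regular graph, a quadratic polynomial in the adjacency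
matrix which kills all but one further simple eigenvalue `θ` and has constant
diagonal shows that the eigenvectors of `θ` are multiples of a `±1`-vector. -/
theorem exists_sign_eigenvector {d : ℕ} (hd : G.IsRegularOfDegree d) [Nonempty V] {θ b c : ℝ}
    (hlam : (graphSpectrum G).count (d : ℝ) = 1)
    (hθ : (graphSpectrum G).count θ = 1) (hne : θ ≠ (d : ℝ)) (hb : θ ^ 2 + b * θ + c ≠ 0)
    (hquad : ∀ x ∈ graphSpectrum G, x ≠ (d : ℝ) → x ≠ θ → x ^ 2 + b * x + c = 0) :
    ∃ s : V → ℝ, (∀ x, s x = 1 ∨ s x = -1) ∧ ∑ x, s x = 0 ∧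
      G.adjMatrix ℝ *ᵥ s = θ • s ∧
      ∀ x y, (Fintype.card V : ℝ) * ((G.adjMatrix ℝ ^ 2) x y + b * G.adjMatrix ℝ x y +
        c * (1 : Matrix V V ℝ) x y) =
        ((d : ℝ) ^ 2 + b * (d : ℝ) + c) + (θ ^ 2 + b * θ + c) * (s x * s y) := by
  have hA : (G.adjMatrix ℝ).IsHermitian := SimpleGraph.isHermitian_adjMatrix ..
  obtain ⟨ev, w, hroots, hrow, hcol, hev⟩ := hA.exists_eigensystem
  change graphSpectrum G = _ at hroots
  have hmem : ∀ j, ev j ∈ graphSpectrum G := fun j => by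
    rw [hroots]; exact Multiset.mem_map_of_mem _ (mem_univ j)
  have huniq : ∀ r, (graphSpectrum G).count r = 1 → ∃ i, ev i = r ∧ ∀ j, ev j = r → j = i := by
    intro r hr
    rw [hroots, Multiset.count_map] at hr
    change (univ.filter fun a => r = ev a).card = 1 at hr
    obtain ⟨i, hi⟩ := card_eq_one.mp hr
    have hi' : ∀ j, r = ev j ↔ j = i := fun j => by
      have := congrArg (j ∈ ·) hi
      simpa using this
    exact ⟨i, ((hi' i).mpr rfl).symm, fun j hj => (hi' j).mp hj.symm⟩
  obtain ⟨i, hi, hiu⟩ := huniq d hlam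
  obtain ⟨l, hl, hlu⟩ := huniq θ hθ
  have hil : i ≠ l := fun h => hne (by rw [← hl, ← hi, h])
  have hcoef := hd.mul_sum_eigenvector_eq_zero hev
  have hexp : ∀ y, ∑ j, (∑ x, w j x) * w j y = 1 := by
    intro y
    simp_rw [sum_mul]
    rw [sum_comm]
    simp [hcol]
  have hzero : ∀ j, j ≠ i → ∑ x, w j x = 0 := fun j hj =>
    (mul_eq_zero.mp (hcoef j)).resolve_left fun h0 =>
      hj (hiu j (by linarith))
  have hwi : ∀ y, (∑ x, w i x) * w i y = 1 := by
    intro y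
    refine Eq.trans (Eq.symm ?_) (hexp y)
    refine sum_eq_single i (fun j _ hj => ?_) fun h => absurd (mem_univ i) h
    rw [hzero j hj, zero_mul]
  set N := (Fintype.card V : ℝ) with hN
  have hNpos : 0 < N := by rw [hN]; exact_mod_cast Fintype.card_pos
  have hsq : (∑ x, w i x) ^ 2 = N := by
    have : ∑ y, (∑ x, w i x) * w i y = N := by simp [hwi, hN]
    rw [← this, ← mul_sum, sq]
  have hii : ∀ x y, N * (w i x * w i y) = 1 := fun x y => by
    rw [← hsq]
    linear_combination ((∑ x, w i x) * w i y) * hwi x + hwi y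
  have hform : ∀ x y, N * ((G.adjMatrix ℝ ^ 2) x y + b * G.adjMatrix ℝ x y +
        c * (1 : Matrix V V ℝ) x y) =
        ((d : ℝ) ^ 2 + b * (d : ℝ) + c) + (θ ^ 2 + b * θ + c) * (N * (w l x * w l y)) := by
    intro x y
    have h2 := Matrix.pow_apply_eq_sum_eigensystem hcol hev 2 x y
    have h1 := Matrix.pow_apply_eq_sum_eigensystem hcol hev 1 x y
    have h0 := Matrix.pow_apply_eq_sum_eigensystem hcol hev 0 x y
    rw [pow_one] at h1
    rw [pow_zero] at h0
    have hsum : (G.adjMatrix ℝ ^ 2) x y + b * G.adjMatrix ℝ x y + c * (1 : Matrix V V ℝ) x y =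
        ∑ j, (ev j ^ 2 + b * ev j + c) * (w j x * w j y) := by
      rw [h2, h1, h0, mul_sum, mul_sum, ← sum_add_distrib, ← sum_add_distrib]
      exact sum_congr rfl fun j _ => by ring
    rw [hsum, ← sum_subset (subset_univ {i, l}), sum_pair hil, hi, hl]
    · linear_combination ((d : ℝ) ^ 2 + b * (d : ℝ) + c) * hii x y
    · intro j _ hj
      simp only [mem_insert, mem_singleton, not_or] at hj
      rw [hquad _ (hmem j) (fun h => hj.1 (hiu j h)) (fun h => hj.2 (hlu j h)), zero_mul]
  have hdeg : ∀ x, (G.adjMatrix ℝ ^ 2) x x = d := fun x => by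
    rw [sq, SimpleGraph.adjMatrix_mul_self_apply_self, hd x]
  -- The quadratic in `A` has diagonal entries `d + c`; solve `hform x x` for the square.
  obtain ⟨r, hr⟩ : ∃ r, ∀ x, w l x ^ 2 = r := by
    refine ⟨(N * (d + c) - ((d : ℝ) ^ 2 + b * (d : ℝ) + c)) / ((θ ^ 2 + b * θ + c) * N), fun x => ?_⟩
    rw [eq_div_iff (mul_ne_zero hb hNpos.ne')]
    have := hform x x
    rw [hdeg] at this
    simp only [SimpleGraph.adjMatrix_apply, SimpleGraph.irrefl, if_false, Matrix.one_apply_eq]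
      at this
    linarith
  have hrN : N * r = 1 := by
    have := hrow l l
    simp only [← sq, hr, if_true] at this
    simpa [hN] using this
  refine ⟨fun x => Real.sqrt N * w l x, fun x => ?_, ?_, ?_, fun x y => ?_⟩
  · rw [← sq_eq_one_iff, mul_pow, Real.sq_sqrt hNpos.le, hr, hrN]
  · rw [← mul_sum, hzero l hil.symm, mul_zero]
  · have : (fun x => Real.sqrt N * w l x) = Real.sqrt N • w l := rfl
    rw [this, Matrix.mulVec_smul, hev, hl, smul_comm]
  · rw [hform x y]
    linear_combination -(θ ^ 2 + b * θ + c) * (w l x * w l y) * Real.mul_self_sqrt hNpos.le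

end Graph

/-! ### Coordinates on the blown-up cube. -/

section Fibers

open Finset

theorem exists_equiv_prod_of_card_fiber {V W : Type*} [Fintype V] [DecidableEq W] (f : V → W)
    (m : ℕ) (h : ∀ b, (univ.filter fun x => f x = b).card = m) :
    ∃ e : V ≃ W × Fin m, ∀ x, (e x).1 = f x := by
  have h' : ∀ b, Nonempty ({x // f x = b} ≃ Fin m) := fun b =>
    ⟨Fintype.equivFinOfCardEq (by rw [Fintype.card_subtype, h b])⟩
  let e := fun b => (h' b).some
  exact ⟨(Equiv.sigmaFiberEquiv f).symm.trans
    ((Equiv.sigmaCongrRight e).trans (Equiv.sigmaEquivProd W (Fin m))), fun x => rfl⟩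

/-- The vertices of the cube, as an even word (coded by an element of `Fin 4`) or the antipode of
an even word. -/
def cubeWord (p : Bool × Fin 4) : Fin 3 → Bool :=
  fun j => xor p.1 (![decide (2 ≤ p.2.val), decide (p.2.val % 2 = 1),
    xor (decide (2 ≤ p.2.val)) (decide (p.2.val % 2 = 1))] j)

theorem cubeWord_bijective : Function.Bijective cubeWord := by
  rw [Fintype.bijective_iff_injective_and_card]
  refine ⟨?_, by simp⟩
  intro p q
  revert p q
  decide

/-- Distinct nonadjacent words are at distance 2 (same parity, different antipodal pairs) or 3
(opposite parity, same pair). -/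
theorem cubeWord_adj (p q : Bool × Fin 4) :
    (cubeWord p ≠ cubeWord q ∧ ¬ cubeGraph.Adj (cubeWord p) (cubeWord q)) ↔
      (p.1 = q.1 ↔ p.2 ≠ q.2) := by
  change (cubeWord p ≠ cubeWord q ∧ ¬ hammingDist (cubeWord p) (cubeWord q) = 1) ↔ _
  revert p q
  decide

theorem compl_circledastJ_adj {V : Type*} (G : SimpleGraph V) (m : ℕ) (p q : V × Fin m) :
    (circledastJ G m)ᶜ.Adj p q ↔ p.1 ≠ q.1 ∧ ¬ G.Adj p.1 q.1 := by
  rw [SimpleGraph.compl_adj]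
  change p ≠ q ∧ ¬ (p ≠ q ∧ (p.1 = q.1 ∨ G.Adj p.1 q.1)) ↔ _
  constructor
  · rintro ⟨h1, h2⟩
    exact ⟨fun h => h2 ⟨h1, Or.inl h⟩, fun h => h2 ⟨h1, Or.inr h⟩⟩
  · rintro ⟨h1, h2⟩
    exact ⟨fun h => h1 (congrArg Prod.fst h), fun h => h.2.elim h1 h2⟩

end Fibers

/-! ### Regular graphs with a `±1` eigenvector. -/

section Signs

open Matrix Finset

variable {V : Type*} {s : V → ℝ}

theorem two_mul_card_filter_sign_eq (hs : ∀ x, s x = 1 ∨ s x = -1) (T : Finset V) (x : V) :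
    2 * ((T.filter fun y => s y = s x).card : ℝ) = T.card + s x * ∑ y ∈ T, s y := by
  rw [← sum_boole, mul_sum, mul_sum, card_eq_sum_ones, Nat.cast_sum, ← sum_add_distrib]
  refine sum_congr rfl fun y _ => ?_
  rcases hs x with h | h <;> rcases hs y with h' | h' <;> rw [h, h'] <;> norm_num

theorem two_mul_card_filter_sign_ne (hs : ∀ x, s x = 1 ∨ s x = -1) (T : Finset V) (x : V) :
    2 * ((T.filter fun y => s y ≠ s x).card : ℝ) = T.card - s x * ∑ y ∈ T, s y := by
  have h := card_filter_add_card_filter_not (s := T) fun y => s y = s x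
  have h1 := two_mul_card_filter_sign_eq hs T x
  have h2 : (((T.filter fun y => s y = s x).card : ℝ) +
    (T.filter fun y => ¬ s y = s x).card) = T.card := by exact_mod_cast h
  linarith

theorem mul_self_of_sign (hs : ∀ x, s x = 1 ∨ s x = -1) (x : V) : s x * s x = 1 := by
  rcases hs x with h | h <;> rw [h] <;> norm_num

theorem mul_of_sign_ne (hs : ∀ x, s x = 1 ∨ s x = -1) {x y : V} (h : s x ≠ s y) :
    s x * s y = -1 := by
  rcases hs x with hx | hx <;> rcases hs y with hy | hy <;> rw [hx, hy] at h ⊢ <;>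
    first | exact absurd rfl h | norm_num

theorem sign_eq_of_ne (hs : ∀ x, s x = 1 ∨ s x = -1) {x y z : V} (h : s x ≠ s y)
    (h' : s z ≠ s y) : s x = s z := by
  rcases hs x with h1 | h1 <;> rcases hs y with h2 | h2 <;> rcases hs z with h3 | h3 <;>
    first
    | exact absurd (h1.trans h2.symm) h
    | exact absurd (h3.trans h2.symm) h'
    | exact h1.trans h3.symm

variable [Fintype V] {G : SimpleGraph V} [DecidableRel G.Adj]

theorem two_mul_card_neighbor_sign_eq (hs : ∀ x, s x = 1 ∨ s x = -1) {d : ℕ}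
    (hd : G.IsRegularOfDegree d) {θ : ℝ} (hθ : G.adjMatrix ℝ *ᵥ s = θ • s) (x : V) :
    2 * (((G.neighborFinset x).filter fun y => s y = s x).card : ℝ) = d + θ := by
  rw [two_mul_card_filter_sign_eq hs, ← SimpleGraph.adjMatrix_mulVec_apply, hθ,
    G.card_neighborFinset_eq_degree, hd x, Pi.smul_apply, smul_eq_mul]
  linear_combination θ * mul_self_of_sign hs x

theorem two_mul_card_neighbor_sign_ne (hs : ∀ x, s x = 1 ∨ s x = -1) {d : ℕ}
    (hd : G.IsRegularOfDegree d) {θ : ℝ} (hθ : G.adjMatrix ℝ *ᵥ s = θ • s) (x : V) :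
    2 * (((G.neighborFinset x).filter fun y => s y ≠ s x).card : ℝ) = d - θ := by
  rw [two_mul_card_filter_sign_ne hs, ← SimpleGraph.adjMatrix_mulVec_apply, hθ,
    G.card_neighborFinset_eq_degree, hd x, Pi.smul_apply, smul_eq_mul]
  linear_combination -θ * mul_self_of_sign hs x

variable [DecidableEq V]

/-- A regular graph with spectrum `c * μ, μ, 0, -μ` (with `c * μ` simple) has no simple
eigenvalue `0`. -/
theorem not_sign_kernel [Nonempty V] (hs : ∀ x, s x = 1 ∨ s x = -1) (hsum : ∑ x, s x = 0)
    {c μ : ℝ} (hc : 2 ≤ c) (hμ : 0 < μ) (hcard : 4 ≤ Fintype.card V)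
    (htr : (Fintype.card V : ℝ) * c = μ * (c ^ 2 + Fintype.card V - 2))
    (hquad : ∀ x y, (Fintype.card V : ℝ) * ((G.adjMatrix ℝ ^ 2) x y -
      μ ^ 2 * (1 : Matrix V V ℝ) x y) = ((c * μ) ^ 2 - μ ^ 2) - μ ^ 2 * (s x * s y)) : False := by
  obtain ⟨x⟩ := ‹Nonempty V›
  have hN4 : (4 : ℝ) ≤ Fintype.card V := by exact_mod_cast hcard
  have h1 := two_mul_card_filter_sign_eq hs univ x
  have h2 := two_mul_card_filter_sign_ne hs univ x
  rw [hsum, mul_zero, card_univ] at h1 h2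
  obtain ⟨y, hy, hyx⟩ : ∃ y ∈ univ.filter (fun y => s y = s x), y ≠ x := by
    apply exists_mem_ne
    have : (1 : ℝ) < (univ.filter fun y => s y = s x).card := by linarith
    exact_mod_cast this
  obtain ⟨z, hz⟩ : (univ.filter fun y => s y ≠ s x).Nonempty := by
    rw [← card_pos]
    have : (0 : ℝ) < (univ.filter fun y => s y ≠ s x).card := by linarith
    exact_mod_cast this
  simp only [mem_filter, mem_univ, true_and] at hy hz
  have hzx : x ≠ z := fun h => hz (by rw [h])
  have e1 := hquad x y
  have e2 := hquad x z
  rw [Matrix.one_apply_ne hyx.symm, hy, mul_self_of_sign hs, adjMatrix_sq_apply] at e1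
  rw [Matrix.one_apply_ne hzx, mul_of_sign_ne hs (Ne.symm hz), adjMatrix_sq_apply] at e2
  set p := (univ.filter fun w => G.Adj x w ∧ G.Adj y w).card
  set q := (univ.filter fun w => G.Adj x w ∧ G.Adj z w).card
  set N := (Fintype.card V : ℝ)
  have hN : 0 < N := by linarith
  have hpq : N * ((q : ℝ) - p) = 2 * μ ^ 2 := by linarith
  have hpos : (0 : ℝ) < (q : ℝ) - p := by
    have : 0 < N * ((q : ℝ) - p) := by rw [hpq]; positivity
    exact (pos_iff_pos_of_mul_pos this).mp hN
  have hge : (1 : ℝ) ≤ (q : ℝ) - p := by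
    have h : p < q := by exact_mod_cast sub_pos.mp hpos
    have : ((p + 1 : ℕ) : ℝ) ≤ q := by exact_mod_cast h
    push_cast at this
    linarith
  set γ := (q : ℝ) - p
  -- Eliminate `N` between `htr`, that is `N(c - μ) = μ(c² - 2)`, and `Nγ = 2μ²`.
  have key : 2 * μ * c = γ * (c ^ 2 - 2) + 2 * μ ^ 2 := by
    have h : μ * (2 * μ * c) = μ * (γ * (c ^ 2 - 2) + 2 * μ ^ 2) := by
      linear_combination γ * htr + (μ - c) * hpq
    exact mul_left_cancel₀ hμ.ne' h
  -- As `γ ≥ 1`, `c² - 2 ≤ 2μ(c - μ) ≤ c²/2`. Then `μ = 1`, and `htr` gives `N = 2`.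
  have hc2 : c = 2 := by
    nlinarith [sq_nonneg (μ - c / 2), mul_nonneg (sub_nonneg.mpr hge) (show 0 ≤ c ^ 2 - 2 by
      nlinarith)]
  subst hc2
  have hμ1 : μ = 1 := by nlinarith [sq_nonneg (μ - 1)]
  subst hμ1
  nlinarith

/-- A regular graph whose spectrum is `c * μ, μ, 0, -μ`, with both `c * μ` and `μ` simple, is the
complement of a blow-up of the cube. -/
theorem exists_iso_compl_circledastJ_cubeGraph [Nonempty V] (hs : ∀ x, s x = 1 ∨ s x = -1)
    (hsum : ∑ x, s x = 0) {d : ℕ} (hd : G.IsRegularOfDegree d) {c μ : ℝ} (hc : 2 ≤ c)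
    (hμ : 0 < μ) (hdc : c * μ = d) (hev : G.adjMatrix ℝ *ᵥ s = μ • s)
    (htr : (Fintype.card V : ℝ) * c = μ * (c ^ 2 + c + 2))
    (hquad : ∀ x y, (Fintype.card V : ℝ) * ((G.adjMatrix ℝ ^ 2) x y + μ * G.adjMatrix ℝ x y) =
      ((c * μ) ^ 2 + μ * (c * μ)) + 2 * μ ^ 2 * (s x * s y)) :
    ∃ m : ℕ, μ = 2 * (m : ℝ) ∧ Nonempty (G ≃g (circledastJ cubeGraph m)ᶜ) := by
  have hNpos : 0 < (Fintype.card V : ℝ) := by exact_mod_cast Fintype.card_pos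
  have hsame := two_mul_card_neighbor_sign_eq hs hd hev
  have hopp := two_mul_card_neighbor_sign_ne hs hd hev
  have hhalf := two_mul_card_filter_sign_eq hs univ
  have hhalf' := two_mul_card_filter_sign_ne hs univ
  simp only [hsum, mul_zero, card_univ] at hhalf hhalf'
  -- nonadjacent vertices of equal sign are twins
  have hsub : ∀ x y, s x = s y → ¬ G.Adj x y → ∀ z, G.Adj x z → G.Adj y z := by
    intro x y hxy hadj z hz
    have e := hquad x y
    rw [adjMatrix_sq_apply, ← hxy, mul_self_of_sign hs, SimpleGraph.adjMatrix_apply, if_neg hadj] at e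
    have hcardeq : (univ.filter fun w => G.Adj x w ∧ G.Adj y w).card = d := by
      have : ((univ.filter fun w => G.Adj x w ∧ G.Adj y w).card : ℝ) = d := by
        rw [← hdc]
        apply mul_left_cancel₀ hNpos.ne'
        linear_combination e - μ * htr
      exact_mod_cast this
    have heq : (univ.filter fun w => G.Adj x w ∧ G.Adj y w) = G.neighborFinset x := by
      apply eq_of_subset_of_card_le
      · intro w hw
        simp only [mem_filter] at hw
        simpa using hw.2.1
      · rw [G.card_neighborFinset_eq_degree, hd x, hcardeq]
    have : z ∈ G.neighborFinset x := by simpa using hz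
    rw [← heq] at this
    exact (mem_filter.mp this).2.2
  have htwin : ∀ x y, s x = s y → ¬ G.Adj x y → ∀ z, G.Adj x z ↔ G.Adj y z := fun x y h hadj z =>
    ⟨hsub x y h hadj z, hsub y x h.symm (fun h' => hadj h'.symm) z⟩
  -- a nonadjacent pair of opposite signs determines the parameters
  have hN : (Fintype.card V : ℝ) = 4 * μ := by
    obtain ⟨x⟩ := ‹Nonempty V›
    obtain ⟨z, hz, hxz⟩ : ∃ z, s z ≠ s x ∧ ¬ G.Adj x z := by
      -- Otherwise all `N/2` vertices of opposite sign would be among the `(d - μ)/2` opposite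
      -- neighbours of `x`, although `d < N`.
      by_contra! hall
      have hle : (univ.filter fun y => s y ≠ s x).card ≤
          ((G.neighborFinset x).filter fun y => s y ≠ s x).card := by
        apply card_le_card
        intro y hy
        simp only [mem_filter, mem_univ, true_and] at hy
        simpa [hy] using hall y hy
      have hlt : (d : ℝ) < Fintype.card V := by
        have := G.degree_lt_card_verts x
        rw [hd x] at this
        exact_mod_cast this
      have hle' : ((univ.filter fun y => s y ≠ s x).card : ℝ) ≤
          ((G.neighborFinset x).filter fun y => s y ≠ s x).card := by exact_mod_cast hle
      have := hopp x
      have := hhalf' x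
      linarith
    -- A neighbour `w` of `z` with the sign of `x` is adjacent to `x`, since otherwise the twins `w`
    -- and `x` would both be adjacent to `z`. By symmetry the common neighbours are the
    -- opposite-sign neighbours of `x` and of `z`, `(d - μ)/2` each.
    have hcommon : ((univ.filter fun w => G.Adj x w ∧ G.Adj z w).card : ℝ) = d - μ := by
      have h1 : ((univ.filter fun w => G.Adj x w ∧ G.Adj z w).filter fun w => s w = s x) =
          (G.neighborFinset z).filter fun w => s w ≠ s z := by
        ext w
        simp only [mem_filter, mem_univ, true_and, SimpleGraph.mem_neighborFinset]
        constructor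
        · rintro ⟨⟨_, h⟩, hw⟩
          exact ⟨h, by rw [hw]; exact hz.symm⟩
        · rintro ⟨h, hw⟩
          have hwx : s w = s x := sign_eq_of_ne hs hw hz.symm
          refine ⟨⟨?_, h⟩, hwx⟩
          by_contra hadj
          exact hxz ((htwin x w hwx.symm hadj z).mpr h.symm)
      have h2 : ((univ.filter fun w => G.Adj x w ∧ G.Adj z w).filter fun w => ¬ s w = s x) =
          (G.neighborFinset x).filter fun w => s w ≠ s x := by
        ext w
        simp only [mem_filter, mem_univ, true_and, SimpleGraph.mem_neighborFinset]
        constructor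
        · rintro ⟨⟨h, _⟩, hw⟩
          exact ⟨h, hw⟩
        · rintro ⟨h, hw⟩
          have hwz : s w = s z := sign_eq_of_ne hs hw hz
          refine ⟨⟨h, ?_⟩, hw⟩
          by_contra hadj
          exact hxz ((htwin z w hwz.symm hadj x).mpr h.symm).symm
      have hadd := card_filter_add_card_filter_not
        (s := univ.filter fun w => G.Adj x w ∧ G.Adj z w) fun w => s w = s x
      rw [h1, h2] at hadd
      rw [← hadd]
      push_cast
      linarith [hopp x, hopp z]
    have e := hquad x z
    rw [adjMatrix_sq_apply, hcommon, mul_of_sign_ne hs hz.symm, SimpleGraph.adjMatrix_apply,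
      if_neg hxz, ← hdc] at e
    apply mul_left_cancel₀ hμ.ne'
    linear_combination μ * htr - e
  have hc2 : c = 2 := by
    rw [hN] at htr
    have : μ * ((c - 1) * (c - 2)) = 0 := by linear_combination -htr
    rcases mul_eq_zero.mp ((mul_eq_zero.mp this).resolve_left hμ.ne') with h | h <;> linarith
  subst hc2
  obtain ⟨m, hm⟩ : ∃ m : ℕ, μ = 2 * (m : ℝ) := by
    obtain ⟨x⟩ := ‹Nonempty V›
    exact ⟨((G.neighborFinset x).filter fun y => s y ≠ s x).card, by rw [hopp x]; linarith⟩
  refine ⟨m, hm, ?_⟩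
  have hmpos : 0 < m := by
    have : (0 : ℝ) < m := by linarith
    exact_mod_cast this
  have hoppcard : ∀ x, (univ.filter fun y => s y ≠ s x ∧ G.Adj x y).card = m := by
    intro x
    have h1 : (univ.filter fun y => s y ≠ s x ∧ G.Adj x y) =
        (G.neighborFinset x).filter fun y => s y ≠ s x := by
      ext y; simp [and_comm]
    have : ((univ.filter fun y => s y ≠ s x ∧ G.Adj x y).card : ℝ) = m := by
      rw [h1]
      linarith [hopp x]
    exact_mod_cast this
  have hsamecard : ∀ x, (univ.filter fun y => s y = s x ∧ ¬ G.Adj x y).card = m := by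
    intro x
    have h1 : ((univ.filter fun y => s y = s x).filter fun y => G.Adj x y) =
        (G.neighborFinset x).filter fun y => s y = s x := by
      ext y; simp [and_comm]
    have hadd := card_filter_add_card_filter_not
      (s := univ.filter fun y => s y = s x) fun y => G.Adj x y
    rw [h1, filter_filter] at hadd
    have hadd' : ((((G.neighborFinset x).filter fun y => s y = s x).card : ℝ) +
      (univ.filter fun y => s y = s x ∧ ¬ G.Adj x y).card) =
        (univ.filter fun y => s y = s x).card := by exact_mod_cast hadd
    have : ((univ.filter fun y => s y = s x ∧ ¬ G.Adj x y).card : ℝ) = m := by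
      linarith [hsame x, hhalf x]
    exact_mod_cast this
  -- The twin class of `x` lies in the opposite neighbourhood of `y`, and both have `m` elements, so
  -- they coincide.
  have hopptwin : ∀ x y z, s x ≠ s y → s z = s x → G.Adj x y → G.Adj z y → ¬ G.Adj x z := by
    intro x y z hxy hzx h1 h2
    have heq : (univ.filter fun w => s w = s x ∧ ¬ G.Adj x w) =
        univ.filter fun w => s w ≠ s y ∧ G.Adj y w := by
      apply eq_of_subset_of_card_le
      · intro w hw
        simp only [mem_filter, mem_univ, true_and] at hw ⊢
        exact ⟨by rw [hw.1]; exact hxy, ((htwin x w hw.1.symm hw.2 y).mp h1).symm⟩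
      · rw [hoppcard, hsamecard]
    have hz : z ∈ univ.filter fun w => s w ≠ s y ∧ G.Adj y w := by
      simp [hzx, hxy, h2.symm]
    rw [← heq] at hz
    exact (mem_filter.mp hz).2.2
  -- A class joins a twin class to the opposite-sign twin class completely adjacent to it; it plays
  -- the role of an antipodal pair of the cube.
  let R : Setoid V :=
    { r := fun x y => s x = s y ↔ ¬ G.Adj x y
      iseqv :=
        { refl := fun x => by simp
          symm := fun {x y} h => by rw [G.adj_comm, eq_comm]; exact h
          trans := fun {x y z} hxy hyz => by
            by_cases h1 : s x = s y <;> by_cases h2 : s y = s z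
            · rw [htwin x y h1 (hxy.mp h1) z, h1]
              exact hyz
            · rw [htwin x y h1 (hxy.mp h1) z, h1]
              exact hyz
            · rw [G.adj_comm, ← htwin y z h2 (hyz.mp h2) x, ← h2, G.adj_comm]
              exact hxy
            · have hxz : s z = s x := sign_eq_of_ne hs (Ne.symm h2) h1
              have a1 : G.Adj x y := by by_contra h; exact h1 (hxy.mpr h)
              have a2 : G.Adj z y := by by_contra h; exact h2 (hyz.mpr fun h' => h h'.symm)
              exact ⟨fun _ => hopptwin x y z h1 hxz a1 a2, fun _ => hxz.symm⟩ } }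
  classical
  have hRr : ∀ x y, (Quotient.mk R x = Quotient.mk R y) ↔ (s x = s y ↔ ¬ G.Adj x y) :=
    fun x y => Quotient.eq
  have hbit : ∀ x y, (decide (s x = 1) = decide (s y = 1)) ↔ s x = s y := by
    intro x y
    rcases hs x with h1 | h1 <;> rcases hs y with h2 | h2 <;> rw [h1, h2] <;> norm_num
  let f : V → Bool × Quotient R := fun x => (decide (s x = 1), Quotient.mk R x)
  have hneg : ∀ x, ∃ y, s y ≠ s x ∧ G.Adj x y := fun x => by
    obtain ⟨y, hy⟩ := card_pos.mp ((hoppcard x).symm ▸ hmpos)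
    exact ⟨y, (mem_filter.mp hy).2⟩
  have hsurj : ∀ b, ∃ x, f x = b := by
    rintro ⟨b, q⟩
    induction q using Quotient.inductionOn with
    | _ x =>
      by_cases hb : decide (s x = 1) = b
      · exact ⟨x, by rw [← hb]⟩
      · obtain ⟨y, hy, hxy⟩ := hneg x
        refine ⟨y, Prod.ext ?_ ((hRr y x).mpr ?_)⟩
        · have : decide (s y = 1) ≠ decide (s x = 1) := fun h => hy ((hbit y x).mp h)
          change decide (s y = 1) = b
          revert this hb
          cases b <;> cases decide (s y = 1) <;> cases decide (s x = 1) <;> simp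
        · exact ⟨fun h => absurd h hy, fun h => absurd hxy.symm h⟩
  have hfib : ∀ b, (univ.filter fun x => f x = b).card = m := by
    intro b
    obtain ⟨x, rfl⟩ := hsurj b
    rw [← hsamecard x]
    congr 1
    ext y
    simp only [mem_filter, mem_univ, true_and, f, Prod.mk.injEq, hbit, hRr, G.adj_comm y x]
    tauto
  -- There are `4μ = 8m` vertices, in fibres of size `m` over sign and class.
  have hQ : Fintype.card (Quotient R) = 4 := by
    have h := card_eq_sum_card_fiberwise (f := f) (s := univ) (t := univ) fun _ _ => mem_univ _
    simp only [hfib, sum_const, smul_eq_mul, card_univ, Fintype.card_prod, Fintype.card_bool] at h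
    have hV : Fintype.card V = 8 * m := by
      have : (Fintype.card V : ℝ) = (8 * m : ℕ) := by push_cast; linarith
      exact_mod_cast this
    rw [hV] at h
    have : 4 * m = Fintype.card (Quotient R) * m := by linarith
    exact (Nat.eq_of_mul_eq_mul_right hmpos this).symm
  obtain ⟨e, he⟩ := exists_equiv_prod_of_card_fiber f m hfib
  let g : Bool × Quotient R ≃ (Fin 3 → Bool) :=
    ((Equiv.refl Bool).prodCongr (Fintype.equivFinOfCardEq hQ)).trans
      (Equiv.ofBijective cubeWord cubeWord_bijective)
  refine ⟨⟨e.trans (g.prodCongr (Equiv.refl (Fin m))), ?_⟩⟩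
  intro x y
  rw [compl_circledastJ_adj]
  change (g (e x).1 ≠ g (e y).1 ∧ ¬ cubeGraph.Adj (g (e x).1) (g (e y).1)) ↔ _
  rw [he, he]
  have := cubeWord_adj ((f x).1, Fintype.equivFinOfCardEq hQ (f x).2)
    ((f y).1, Fintype.equivFinOfCardEq hQ (f y).2)
  refine this.trans ?_
  simp only [f, hbit, ne_eq, EmbeddingLike.apply_eq_iff_eq, hRr]
  tauto

end Signs

/-! ### The main theorem. -/

open Matrix in
theorem theorem3 {V : Type*} [Fintype V] [DecidableEq V] (G : SimpleGraph V)
    [DecidableRel G.Adj] (hconn : G.Connected) (n k t : ℕ) (hn : Fintype.card V = n)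
    (ht : 1 ≤ t) (hk : 1 ≤ k) (htk : t + k + 2 ≤ n)
    (lam mu : ℝ) (hmu : 0 < mu) (hlam : mu < lam)
    (hspec : graphSpectrum G =
      {lam} + Multiset.replicate (n - k - t - 1) mu + Multiset.replicate t 0 +
        Multiset.replicate k (-mu)) :
    IsIntegralGraph G ∧
      ((∃ d : ℕ, G.IsRegularOfDegree d) →
        Xor
          (∃ m : ℕ, mu = 2 * (m : ℝ) ∧ Nonempty (G ≃g (circledastJ cubeGraph m)ᶜ))
          (∀ x : ℝ, IsSimpleEigenvalue G x ↔ x = lam)) := by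
  have : Nonempty V := hconn.nonempty
  have hA : (G.adjMatrix ℝ).IsHermitian := SimpleGraph.isHermitian_adjMatrix ..
  obtain ⟨a, ha⟩ : ∃ a, a = n - k - t - 1 := ⟨_, rfl⟩
  rw [← ha] at hspec
  have ha1 : 1 ≤ a := by omega
  have hna : n = a + k + t + 1 := by omega
  have hsum : ∀ p : ℕ, ((graphSpectrum G).map (· ^ p)).sum =
      lam ^ p + a * mu ^ p + t * 0 ^ p + k * (-mu) ^ p := fun p => by
    rw [hspec]; simp; ring
  have htr1 : lam + a * mu - k * mu = 0 := by
    have h := hA.trace_pow_eq_sum_roots 1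
    rw [pow_one, SimpleGraph.trace_adjMatrix] at h
    have h' := hsum 1
    rw [graphSpectrum, ← h] at h'
    linear_combination -h'
  obtain ⟨c, hc⟩ : ∃ c : ℤ, c = k - a := ⟨_, rfl⟩
  have hcR : (c : ℝ) = k - a := by rw [hc]; push_cast; ring
  have hlamc : lam = c * mu := by rw [hcR]; linear_combination htr1
  have hc2 : 2 ≤ c := by
    have : (1 : ℝ) < c := by
      by_contra! h
      nlinarith
    have : 1 < c := by exact_mod_cast this
    omega
  have hc2R : (2 : ℝ) ≤ c := by exact_mod_cast hc2
  have hmem : ∀ x ∈ graphSpectrum G, x = lam ∨ x = mu ∨ x = 0 ∨ x = -mu := by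
    intro x hx
    rw [hspec] at hx
    simp only [Multiset.mem_add, Multiset.mem_singleton, Multiset.mem_replicate] at hx
    tauto
  have hnegmem : -mu ∈ graphSpectrum G := by
    rw [hspec, Multiset.mem_add, Multiset.mem_replicate]
    exact Or.inr ⟨by omega, rfl⟩
  have hint : ∃ z : ℤ, mu = z := by
    obtain ⟨z2, hz2⟩ := exists_int_sum_graphSpectrum_pow (G := G) 2
    obtain ⟨z3, hz3⟩ := exists_int_sum_graphSpectrum_pow (G := G) 3
    rw [hsum, hlamc] at hz2 hz3
    have e2 : mu ^ 2 * (c ^ 2 + a + k) = z2 := by linear_combination hz2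
    have e3 : mu ^ 3 * (c ^ 3 - c) = z3 := by rw [← hz3, hcR]; ring
    have hpos : 0 < (c : ℝ) ^ 3 - c := by nlinarith
    have hpos2 : 0 < (c : ℝ) ^ 2 + a + k := by positivity
    have hz2pos : (0 : ℝ) < z2 := by rw [← e2]; positivity
    -- The quotient of the third power sum by the second is `μ(c³ - c)/(c² + a + k)`; solve for `μ`.
    have hq : mu = ((z3 * (c ^ 2 + a + k) / ((c ^ 3 - c) * z2) : ℚ) : ℝ) := by
      push_cast
      rw [eq_div_iff (mul_pos hpos hz2pos).ne', ← e2, ← e3]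
      ring
    have hnegq : -mu = ((-(z3 * (c ^ 2 + a + k) / ((c ^ 3 - c) * z2)) : ℚ) : ℝ) := by
      rw [Rat.cast_neg, ← hq]
    rw [hnegq] at hnegmem
    obtain ⟨z, hz⟩ := exists_int_of_mem_graphSpectrum_of_rat hnegmem
    rw [← hnegq] at hz
    exact ⟨-z, by push_cast; rw [← hz, neg_neg]⟩
  refine ⟨?_, ?_⟩
  · obtain ⟨z, hz⟩ := hint
    intro x hx
    rcases hmem x hx with h | h | h | h
    · exact ⟨c * z, by rw [h, hlamc, hz]; push_cast; ring⟩
    · exact ⟨z, by rw [h, hz]⟩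
    · exact ⟨0, by rw [h]; simp⟩
    · exact ⟨-z, by rw [h, hz]; simp⟩
  rintro ⟨d, hd⟩
  have h1 : lam ≠ mu := hlam.ne'
  have h2 : lam ≠ 0 := (hmu.trans hlam).ne'
  have h3 : lam ≠ -mu := by linarith
  have h4 : mu ≠ 0 := hmu.ne'
  have h5 : mu ≠ -mu := by linarith
  have h6 : (0 : ℝ) ≠ -mu := by linarith
  have hcount : ∀ x, (graphSpectrum G).count x = (if x = lam then 1 else 0) +
      (if mu = x then a else 0) + (if 0 = x then t else 0) + (if -mu = x then k else 0) := by
    intro x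
    rw [hspec]
    simp only [Multiset.count_add, Multiset.count_singleton, Multiset.count_replicate]
  have hclam : (graphSpectrum G).count lam = 1 := by
    rw [hcount, if_pos rfl, if_neg h1.symm, if_neg h2.symm, if_neg h3.symm]
  have hcmu : (graphSpectrum G).count mu = a := by
    rw [hcount, if_neg h1.symm, if_pos rfl, if_neg h4.symm, if_neg h5.symm]; simp
  have hczero : (graphSpectrum G).count 0 = t := by
    rw [hcount, if_neg h2.symm, if_neg h4, if_pos rfl, if_neg h6.symm]; simp
  have hcneg : (graphSpectrum G).count (-mu) = k := by
    rw [hcount, if_neg h3.symm, if_neg h5, if_neg h6, if_pos rfl]; simp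
  have hmax : ∀ x ∈ graphSpectrum G, x ≤ lam := by
    intro x hx
    rcases hmem x hx with h | h | h | h <;> rw [h] <;> linarith
  have hnR : (n : ℝ) = a + k + t + 1 := by rw [hna]; push_cast; ring
  have htr2 : (n : ℝ) * d = mu ^ 2 * (c ^ 2 + a + k) := by
    have h := hA.trace_pow_eq_sum_roots 2
    have h' := hsum 2
    rw [graphSpectrum, ← h, Matrix.trace, sq] at h'
    simp only [Matrix.diag_apply, SimpleGraph.adjMatrix_mul_self_apply_self, hd _,
      Finset.sum_const, Finset.card_univ, hn, nsmul_eq_mul] at h'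
    rw [h', hlamc]; ring
  have hld : lam = d := eq_degree_of_isGreatest_graphSpectrum hd
    (Multiset.count_pos.mp (by rw [hclam]; exact one_pos)) hmax
  have hkey : (n : ℝ) * c = mu * (c ^ 2 + a + k) := by
    rw [← hld, hlamc] at htr2
    apply mul_left_cancel₀ hmu.ne'
    linear_combination htr2
  have hdcount : (graphSpectrum G).count (d : ℝ) = 1 := by rw [← hld, hclam]
  by_cases ha' : a = 1
  · subst ha'
    have hkc : (k : ℝ) = c + 1 := by rw [hcR]; push_cast; ring
    refine Or.inl ⟨?_, fun hall => h1.symm ((hall mu).mp hcmu)⟩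
    obtain ⟨s, hs, hs0, hsev, hquad⟩ := exists_sign_eigenvector (θ := mu) (b := mu) (c := 0) hd
      hdcount hcmu (by rw [← hld]; exact h1.symm) (by positivity) (by
        intro x hx hx1 hx2
        rcases hmem x hx with h | h | h | h
        · exact absurd (h.trans hld) hx1
        · exact absurd h hx2
        · rw [h]; ring
        · rw [h]; ring)
    refine exists_iso_compl_circledastJ_cubeGraph hs hs0 hd hc2R hmu (by rw [← hlamc, hld]) hsev
      ?_ fun x y => ?_
    · rw [hn, hkey, hkc]; push_cast; ring
    · have h := hquad x y
      rw [← hld, hlamc] at h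
      linear_combination h
  · have ht2 : t ≠ 1 := by
      rintro rfl
      obtain ⟨s, hs, hs0, -, hquad⟩ := exists_sign_eigenvector (θ := 0) (b := 0) (c := -mu ^ 2) hd
        hdcount hczero (by rw [← hld]; exact h2.symm)
        (by rw [zero_pow two_ne_zero, zero_mul, add_zero, zero_add]
            exact neg_ne_zero.mpr (pow_ne_zero 2 hmu.ne')) (by
          intro x hx hx1 hx2
          rcases hmem x hx with h | h | h | h
          · exact absurd (h.trans hld) hx1
          · rw [h]; ring
          · exact absurd h hx2
          · rw [h]; ring)
      refine not_sign_kernel (G := G) hs hs0 hc2R hmu (by omega) ?_ fun x y => ?_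
      · rw [hn, hkey, hnR]; push_cast; ring
      · have h := hquad x y
        rw [← hld, hlamc] at h
        linear_combination h
    have hk1 : k ≠ 1 := by omega
    refine Or.inr ⟨fun x => ⟨fun hx => ?_, fun hx => by rw [hx]; exact hclam⟩, ?_⟩
    · have hxm : x ∈ graphSpectrum G :=
        Multiset.count_pos.mp (by rw [show (graphSpectrum G).count x = 1 from hx]; exact one_pos)
      have hx1 : (graphSpectrum G).count x = 1 := hx
      rcases hmem x hxm with h | h | h | h
      · exact h
      · exact absurd (hcmu.symm.trans (h ▸ hx1)) ha'
      · exact absurd (hczero.symm.trans (h ▸ hx1)) ht2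
      · exact absurd (hcneg.symm.trans (h ▸ hx1)) hk1
    · rintro ⟨m, hm, ⟨e⟩⟩
      have hcard : n = 8 * m := by
        rw [← hn, Fintype.card_congr e.toEquiv]
        simp
      have hcardR : (n : ℝ) = 4 * mu := by rw [hcard, hm]; push_cast; ring
      -- With `n = 4μ` and `k = a + c` the walk count reads `(c - 1)(c - 2) = 2 - 2a`, impossible
      -- for `a ≥ 2`.
      have h : mu * (4 * c) = mu * (c ^ 2 + c + 2 * a) := by
        rw [hcardR] at hkey
        linear_combination hkey - mu * hcR
      have h' : (4 * c : ℤ) = c ^ 2 + c + 2 * a := by exact_mod_cast mul_left_cancel₀ hmu.ne' h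
      have ha2 : (2 : ℤ) ≤ a := by omega
      linarith [mul_nonneg (show (0 : ℤ) ≤ c - 1 by omega) (show (0 : ℤ) ≤ c - 2 by omega),
        show (c - 1) * (c - 2) = c ^ 2 - 3 * c + 2 by ring]
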